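/- **Automata.** A parity automaton $\mathcal A=(\Sigma,Q,q_0,\delta)$ has a finite alphabet, a finite state set, an initial state $q_0$ and transitions $\delta\subseteq Q\times\Sigma\times Q\times\mathbb N$ whose last component (the color) is determined by the other three; it is complete (every state has at least one transition on every letter). We also write $\delta(q,x)$ for the set of successors of $q$ on $x$. A run on $w=x_0x_1\ldots\in\Sigma^\omega$ is accepting if the lowest color occurring infinitely often along it is even; $L(\mathcal A,q)$ is the set of words with an accepting run from $q$, and $L(\mathcal A)=L(\mathcal A,q_0)$. The automaton is co-Büchi if only the colors 1 (rejecting transitions) and 2 (accepting transitions) occur. It is good for games (GFG) from $q$ if there is $f:\Sigma^*\to Q$ such that for every $w$ the sequence $\pi_i=f(x_0\ldots x_{i-1})$ is a run on $w$ from $q$, and it is accepting whenever $w\in L(\mathcal A,q)$; it is GFG if it is GFG from $q_0$. A co-Büchi automaton is a *canonical GFG co-Büchi automaton* (in the sense of Abu Radi and Kupferman) if - all states are reachable, and the automaton is GFG from each of them; - whenever $q'$ can be reached from $q$ by accepting transitions, $q$ can be reached from $q'$ by accepting transitions; - each state has at most one accepting transition on each letter; - any two successors $s,s'$ of a state on the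 same letter satisfy $L(\mathcal A,s)=L(\mathcal A,s')$; - no GFG co-Büchi automaton with the same language has fewer states; - no state has both an accepting and a rejecting transition on the same letter, and if $q$ has no accepting transition on $x$, then every state $s'$ with $L(\mathcal A,s')=L(\mathcal A,s)$ for some $s\in\delta(q,x)$ is itself in $\delta(q,x)$. **Chains.** A *COCOA* is a sequence $\mathcal A^1,\ldots,\mathcal A^n$ of canonical GFG co-Büchi automata $\mathcal A^l=(\Sigma,Q^l,q^l_0,\delta^l)$ over a common alphabet with $L(\mathcal A^1)\supseteq\ldots\supseteq L(\mathcal A^n)$. The *natural color* of a word is the largest $l\in\{1,\ldots,n\}$ such that $\mathcal A^l$ accepts it, or $0$ if there is none. **Restrictions.** Let $L^{acc}(q)$ be the set of words that have a run from $q$ taking accepting transitions only, and let $L^{acc}(q^1,\ldots,q^l)=\bigcap_{i\le l}L^{acc}(q^i)$. *Restriction functions* are functions $g^l:Q^l\times\Sigma\times Q^1\times\cdots\times Q^{l-1}\to 2^{Q^l}$, $l\in\{1,\ldots,n\}$, such that for all $q^l,x,r^1,\ldots,r^{l-1}$ the set $S=g^l(q^l,x,r^1,\ldots,r^{l-1})$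 satisfies - $S\subseteq\delta^l(q^l,x)$; - there are no two distinct $s,s'\in S$ with $L^{acc}(r^1,\ldots,r^{l-1},s')\subseteq L^{acc}(r^1,\ldots,r^{l-1},s)$; - for every $s\in\delta^l(q^l,x)$ there is $s'\in S$ with $L^{acc}(r^1,\ldots,r^{l-1},s)\subseteq L^{acc}(r^1,\ldots,r^{l-1},s')$. So $S$ consists of one representative of each class of undominated successors. Strategies $f^l:\Sigma^*\to Q^l$, $l\in\{1,\ldots,n\}$, *satisfy* $g^1,\ldots,g^n$ if for every word $w=x_0x_1\ldots\in\Sigma^\omega$ the sequences $\rho^l_i=f^l(x_0\ldots x_{i-1})$ are runs of $\mathcal A^l$ on $w$ from $q^l_0$ and $$\rho^l_{i+1}\in g^l(\rho^l_i,x_i,\rho^1_{i+1},\ldots,\rho^{l-1}_{i+1})\qquad\text{for all } l\in\{1,\ldots,n\},\ i\in\mathbb N.$$ **Lemma.** Let $\mathcal A^1,\ldots,\mathcal A^n$ be a COCOA and let $g^1,\ldots,g^n$ be restriction functions for it. Then there exist strategies $f^l:\Sigma^*\to Q^l$, $l\in\{1,\ldots,n\}$, that satisfy $g^1,\ldots,g^n$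 and such that for every word $w\in\Sigma^\omega$, with natural color $c$, the runs $\rho^1,\ldots,\rho^c$ that $f^1,\ldots,f^c$ yield on $w$ are accepting runs of $\mathcal A^1,\ldots,\mathcal A^c$. -/

import Mathlib

/-- A complete nondeterministic parity automaton with colors on transitions, over the alphabet `α`
and the state set `Q`. `trans q x q' c` says that `(q, x, q', c)` is a transition; the color is
determined by the other three components. -/
structure ParityAutomaton (α Q : Type*) where
  init : Q
  trans : Q → α → Q → ℕ → Prop
  color_unique : ∀ q x q' c c', trans q x q' c → trans q x q' c' → c = c'
  complete : ∀ q x, ∃ q' c, trans q x q' c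

namespace ParityAutomaton

variable {α Q : Type*} (A : ParityAutomaton α Q)

/-- The set `δ(q, x)` of successors of `q` on `x`. -/
def succ (q : Q) (x : α) : Set Q := {q' | ∃ c, A.trans q x q' c}

/-- Only colors 1 (rejecting transitions) and 2 (accepting transitions) occur. -/
def IsCoBuchi : Prop := ∀ q x q' c, A.trans q x q' c → c = 1 ∨ c = 2

/-- `π` is a run on the infinite word `w` when the initial state is changed to `q`. -/
def IsRunFrom (q : Q) (w : ℕ → α) (π : ℕ → Q) : Prop :=
  π 0 = q ∧ ∀ i, π (i + 1) ∈ A.succ (π i) (w i)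

/-- The color `c` occurs infinitely often along `π` on `w`. -/
def InfColor (w : ℕ → α) (π : ℕ → Q) (c : ℕ) : Prop :=
  ∃ᶠ i in Filter.atTop, A.trans (π i) (w i) (π (i + 1)) c

/-- `π` is an accepting run on `w` from `q`: the lowest color that occurs infinitely often
is even. -/
def IsAcceptingRunFrom (q : Q) (w : ℕ → α) (π : ℕ → Q) : Prop :=
  A.IsRunFrom q w π ∧ ∃ c, Even c ∧ A.InfColor w π c ∧ ∀ c' < c, ¬ A.InfColor w π c'

/-- The language `L(A, q)`. -/
def langFrom (q : Q) : Set (ℕ → α) := {w | ∃ π, A.IsAcceptingRunFrom q w π}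

/-- The language of the automaton. -/
def lang : Set (ℕ → α) := A.langFrom A.init

/-- The set `L^acc(q)` of words that have a run from `q` taking accepting transitions only
(for co-Büchi automata, where accepting transitions are those of color 2). -/
def accLang (q : Q) : Set (ℕ → α) :=
  {w | ∃ π : ℕ → Q, π 0 = q ∧ ∀ i, A.trans (π i) (w i) (π (i + 1)) 2}

end ParityAutomaton

/-- The state sequence `π_i = f(w_0 … w_{i-1})` that the strategy `f : Σ* → Q` yields on `w`. -/
def strategyRun {α Q : Type*} (f : List α → Q) (w : ℕ → α) : ℕ → Q :=
  fun i => f ((List.range i).map w)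

namespace ParityAutomaton

variable {α Q : Type*} (A : ParityAutomaton α Q)

/-- The automaton, started in `q`, is good for games: some strategy yields a run on every word,
and this run is accepting whenever the word is in the language. -/
def IsGFGFrom (q : Q) : Prop :=
  ∃ f : List α → Q, ∀ w : ℕ → α, A.IsRunFrom q w (strategyRun f w) ∧
    (w ∈ A.langFrom q → A.IsAcceptingRunFrom q w (strategyRun f w))

/-- Good for games. -/
def IsGFG : Prop := A.IsGFGFrom A.init

/-- `q` is reachable from the initial state. -/
def Reachable (q : Q) : Prop :=
  Relation.ReflTransGen (fun p p' => ∃ x, p' ∈ A.succ p x) A.init q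

/-- There is a path of accepting transitions from `q` to `q'`. -/
def AccPath (q q' : Q) : Prop :=
  Relation.ReflTransGen (fun p p' => ∃ x, A.trans p x p' 2) q q'

/-- Nice co-Büchi automata (Abu Radi and Kupferman): every state is reachable and good for games,
and the automaton is normal (accepting transitions do not leave the strongly connected components
of the graph of accepting transitions), safe deterministic (at most one accepting transition per
state and letter) and semantically deterministic (all successors on a letter have the same
language). -/
structure IsNice : Prop where
  reachable : ∀ q, A.Reachable q
  gfg : ∀ q, A.IsGFGFrom q
  normal : ∀ q q', A.AccPath q q' → A.AccPath q' q
  safe_deterministic : ∀ q x s s', A.trans q x s 2 → A.trans q x s' 2 → s = s'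
  semantically_deterministic :
    ∀ q x, ∀ s ∈ A.succ q x, ∀ s' ∈ A.succ q x, A.langFrom s = A.langFrom s'

/-- No good-for-games co-Büchi automaton for the same language has fewer states. -/
def IsMinimalGFG : Prop :=
  ∀ (m : ℕ) (B : ParityAutomaton α (Fin m)),
    B.IsCoBuchi → B.IsGFG → B.lang = A.lang → Nat.card Q ≤ m

/-- Maximality of the rejecting transitions up to homogeneity: no state has both an accepting and
a rejecting transition on the same letter, and if `q` has no accepting transition on `x`, then
every state that is language equivalent to some successor of `q` on `x` is itself a successor
of `q` on `x`. -/
structure IsRejMaximalUpToHomogeneity : Prop where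
  homogeneous : ∀ q x s s', A.trans q x s 1 → ¬ A.trans q x s' 2
  maximal : ∀ q x, (∀ s, ¬ A.trans q x s 2) →
    ∀ s ∈ A.succ q x, ∀ s', A.langFrom s' = A.langFrom s → s' ∈ A.succ q x

/-- The canonical good-for-games co-Büchi automaton of its language: nice, minimal, and maximal
up to homogeneity. It is unique up to isomorphism. -/
structure IsCanonicalGFGCoBuchi : Prop where
  coBuchi : A.IsCoBuchi
  nice : A.IsNice
  minimal : A.IsMinimalGFG
  rejMaximal : A.IsRejMaximalUpToHomogeneity

end ParityAutomaton

section Chain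

variable {α : Type*} {n : ℕ} {Q : Fin n → Type*} (A : (l : Fin n) → ParityAutomaton α (Q l))

/-- A chain of good-for-games co-Büchi automata `A^1, …, A^n`: canonical automata whose languages
form a falling chain. The index `l : Fin n` stands for the level `l + 1`. Strictness of the
inclusions is not required. -/
structure IsCOCOA : Prop where
  canonical : ∀ l, (A l).IsCanonicalGFGCoBuchi
  falling : ∀ j l, j ≤ l → (A l).lang ⊆ (A j).lang

/-- The natural color of `w`: the largest level whose automaton accepts `w`, or 0 if there is
none (`sSup ∅ = 0` in `ℕ`). -/
noncomputable def naturalColor (w : ℕ → α) : ℕ :=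
  sSup {k : ℕ | ∃ l : Fin n, k = (l : ℕ) + 1 ∧ w ∈ (A l).lang}

/-- `L^acc(r^1, …, r^{l-1}, s)`, the intersection of the sets `L^acc(r^1), …, L^acc(r^{l-1})`
and `L^acc(s)`. -/
def jointAccLang (l : Fin n) (r : (j : Fin n) → j < l → Q j) (s : Q l) : Set (ℕ → α) :=
  {w | (∀ j, ∀ hj : j < l, w ∈ (A j).accLang (r j hj)) ∧ w ∈ (A l).accLang s}

/-- `S` is a pruning of the successors of `q` on `x`, given the successors `r` chosen on the lower
levels: no two distinct elements of `S` are comparable with respect to their joint `L^acc` sets,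
and every successor is dominated by an element of `S`. -/
structure IsPruning (l : Fin n) (q : Q l) (x : α) (r : (j : Fin n) → j < l → Q j)
    (S : Set (Q l)) : Prop where
  subset_succ : S ⊆ (A l).succ q x
  antichain : ∀ s ∈ S, ∀ s' ∈ S, jointAccLang A l r s' ⊆ jointAccLang A l r s → s' = s
  dominating : ∀ s ∈ (A l).succ q x, ∃ s' ∈ S, jointAccLang A l r s ⊆ jointAccLang A l r s'

/-- `g` is a family of restriction functions `g^l : Q^l × Σ × Q^1 × … × Q^{l-1} → 2^{Q^l}`. -/
def IsRestriction
    (g : (l : Fin n) → Q l → α → ((j : Fin n) → j < l → Q j) → Set (Q l)) : Prop :=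
  ∀ l q x r, IsPruning A l q x r (g l q x r)

/-- The strategies `f^1, …, f^n` satisfy the restrictions `g^1, …, g^n`: on every word they yield
runs `ρ^1, …, ρ^n` with `ρ^l_{i+1} ∈ g^l(ρ^l_i, w_i, ρ^1_{i+1}, …, ρ^{l-1}_{i+1})`. -/
def SatisfyRestrictions
    (g : (l : Fin n) → Q l → α → ((j : Fin n) → j < l → Q j) → Set (Q l))
    (f : (l : Fin n) → List α → Q l) : Prop :=
  ∀ (w : ℕ → α) (l : Fin n),
    (A l).IsRunFrom (A l).init w (strategyRun (f l) w) ∧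
    ∀ i, strategyRun (f l) w (i + 1) ∈
      g l (strategyRun (f l) w i) (w i) (fun j _ => strategyRun (f j) w (i + 1))

end Chain

/-! Call a successor old if an accepting path leading to it began early; the path may begin in any
state, and what precedes it is irrelevant. At every step, each level takes an oldest successor and
moves to a member of the restriction set that dominates it, given the lower levels' choices.
Acceptance follows by induction on the level `l`. The lower runs are eventually accepting, so the
remaining word lies in their `accLang` sets. Let `σ` be an accepting run of level `l` that only
accepts from position `k` on. At a late rejecting transition of the strategy's run, the state of `σ`
is an available successor (`langFrom_run_eq` and maximality), so the oldest successor accepts since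
`k` too. Safe determinism leaves at most one accepting path per state at position `k`, so late
survivors live forever (`eventually_mem_accLang`). The remaining word thus lies in the joint
language of the oldest successor, hence in that of the dominating state, and the run never rejects
again (`accepting_of_mem_accLang`). -/

namespace ParityAutomaton

variable {α Q : Type*} (A : ParityAutomaton α Q)

/-- Some path on the finite word `v` ends in `p` and takes accepting transitions only from
position `k` on. -/
def AcceptsSince (k : ℕ) (v : List α) (p : Q) : Prop :=
  ∃ π : ℕ → Q, π v.length = p ∧
    ∀ t (h : t < v.length), k ≤ t → A.trans (π t) v[t] (π (t + 1)) 2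

variable {A}

/-- Every nonempty set of states contains an element of maximal age with respect to accepting
paths. -/
theorem exists_oldest (v : List α) {S : Set Q} (hS : S.Nonempty) :
    ∃ s ∈ S, ∀ s' ∈ S, ∀ k, A.AcceptsSince k v s' → A.AcceptsSince k v s := by
  classical
  have hex : ∃ k, ∃ s ∈ S, A.AcceptsSince k v s := by
    obtain ⟨s, hs⟩ := hS
    -- At `k = v.length` the condition is vacuous, so a least `k` exists.
    exact ⟨v.length, s, hs, fun _ => s, rfl, fun t h h' => absurd h (not_lt.2 h')⟩
  obtain ⟨s, hs, π, hπ, hacc⟩ := Nat.find_spec hex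
  exact ⟨s, hs, fun s' hs' k hk =>
    ⟨π, hπ, fun t h hkt => hacc t h ((Nat.find_min' hex ⟨s', hs', hk⟩).trans hkt)⟩⟩

theorem acceptsSince_prefix {k i : ℕ} {w : ℕ → α} {p : Q} :
    A.AcceptsSince k ((List.range i).map w) p ↔
      ∃ π : ℕ → Q, π i = p ∧ ∀ t < i, k ≤ t → A.trans (π t) (w t) (π (t + 1)) 2 := by
  simp [AcceptsSince]

theorem IsNice.accepting_path_unique (hA : A.IsNice) {w : ℕ → α} {k i : ℕ} {π σ : ℕ → Q}
    (hk : π k = σ k) (hki : k ≤ i)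
    (hπ : ∀ t < i, k ≤ t → A.trans (π t) (w t) (π (t + 1)) 2)
    (hσ : ∀ t < i, k ≤ t → A.trans (σ t) (w t) (σ (t + 1)) 2) : π i = σ i := by
  induction i, hki using Nat.le_induction with
  | base => exact hk
  | succ m hm ih =>
    have h := ih (fun t ht => hπ t (by omega)) (fun t ht => hσ t (by omega))
    have h' := hπ m (by omega) hm
    rw [h] at h'
    exact hA.safe_deterministic _ _ _ _ h' (hσ m (by omega) hm)

/-- An accepting path that starts at a fixed position and lives long enough lives forever. -/
theorem IsNice.eventually_mem_accLang [Finite Q] (hA : A.IsNice) (w : ℕ → α) (k : ℕ) :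
    ∀ᶠ i in Filter.atTop, ∀ p, A.AcceptsSince k ((List.range i).map w) p →
      (fun t => w (i + t)) ∈ A.accLang p := by
  have key : ∀ q : Q, ∀ᶠ i in Filter.atTop, ∀ π : ℕ → Q, π k = q →
      (∀ t < i, k ≤ t → A.trans (π t) (w t) (π (t + 1)) 2) →
      (fun t => w (i + t)) ∈ A.accLang (π i) := by
    intro q
    -- Either accepting paths of every length leave `q` at position `k`, and by uniqueness they
    -- extend one another, so their diagonal is infinite; or none survives up to some `d`, and the
    -- claim is vacuous from `d` on.
    by_cases h : ∀ i, ∃ π : ℕ → Q, π k = q ∧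
        ∀ t < i, k ≤ t → A.trans (π t) (w t) (π (t + 1)) 2
    · choose P hP hacc using h
      filter_upwards [Filter.eventually_ge_atTop k] with i hi π hπ hπacc
      refine ⟨fun t => P (i + t) (i + t), ?_, fun t => ?_⟩
      · exact hA.accepting_path_unique (by rw [hP, hπ]) hi (hacc i) hπacc
      · have h1 : P (i + t) (i + t) = P (i + t + 1) (i + t) :=
          hA.accepting_path_unique (by rw [hP, hP]) (by omega) (hacc _)
            (fun u hu => hacc (i + t + 1) u (by omega))
        have h2 := hacc (i + t + 1) (i + t) (by omega) (by omega)
        rw [← h1] at h2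
        exact h2
    · push Not at h
      obtain ⟨d, hd⟩ := h
      filter_upwards [Filter.eventually_ge_atTop d] with i hi π hπ hπacc
      obtain ⟨t, ht, hkt, hn⟩ := hd π hπ
      exact absurd (hπacc t (by omega) hkt) hn
  -- Finiteness of `Q` gives one threshold for all starting states.
  filter_upwards [Filter.eventually_all.2 key] with i hi p hp
  obtain ⟨π, rfl, hπ⟩ := acceptsSince_prefix.1 hp
  exact hi _ π rfl hπ

theorem IsCoBuchi.isAcceptingRunFrom_iff (hA : A.IsCoBuchi) {q : Q} {w : ℕ → α} {π : ℕ → Q} :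
    A.IsAcceptingRunFrom q w π ↔ A.IsRunFrom q w π ∧
      ∀ᶠ i in Filter.atTop, A.trans (π i) (w i) (π (i + 1)) 2 := by
  refine and_congr_right fun hrun => ⟨?_, fun h => ?_⟩
  · rintro ⟨c, hc, hinf, hmin⟩
    have hc2 : c = 2 := by
      obtain ⟨i, hi⟩ := hinf.exists
      rcases hA _ _ _ _ hi with rfl | rfl
      · exact absurd hc (by decide)
      · rfl
    subst hc2
    filter_upwards [Filter.not_frequently.1 (hmin 1 one_lt_two)] with i hi
    obtain ⟨c, hc⟩ := hrun.2 i
    rcases hA _ _ _ _ hc with rfl | rfl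
    · exact absurd hc hi
    · exact hc
  · refine ⟨2, even_two, h.frequently, fun c hc hinf => ?_⟩
    obtain ⟨i, hi, hi'⟩ := (hinf.and_eventually h).exists
    exact hc.ne (A.color_unique _ _ _ _ _ hi hi')

theorem IsCoBuchi.cons_mem_langFrom_iff (hA : A.IsCoBuchi) {q : Q} {w : ℕ → α} :
    w ∈ A.langFrom q ↔ ∃ s ∈ A.succ q (w 0), (fun t => w (t + 1)) ∈ A.langFrom s := by
  constructor
  · rintro ⟨π, hπ⟩
    obtain ⟨⟨h0, hrun⟩, hev⟩ := hA.isAcceptingRunFrom_iff.1 hπ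
    refine ⟨π 1, h0 ▸ hrun 0, fun t => π (t + 1), hA.isAcceptingRunFrom_iff.2
      ⟨⟨rfl, fun i => hrun (i + 1)⟩, (Filter.tendsto_add_atTop_nat 1).eventually hev⟩⟩
  · rintro ⟨s, hs, π, hπ⟩
    obtain ⟨⟨h0, hrun⟩, hev⟩ := hA.isAcceptingRunFrom_iff.1 hπ
    refine ⟨fun t => Nat.casesOn t q π, hA.isAcceptingRunFrom_iff.2 ⟨⟨rfl, ?_⟩, ?_⟩⟩
    · rintro (_ | i)
      · simpa [h0] using hs
      · exact hrun i
    · rw [← Filter.map_add_atTop_eq_nat 1, Filter.eventually_map]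
      exact hev

/-- By semantic determinism, the language after reading `x` depends only on `x` and the language of
`q`, which carries the induction along two runs. -/
theorem IsNice.mem_langFrom_succ_iff (hA : A.IsNice) (hc : A.IsCoBuchi) {q s : Q} {x : α}
    (hs : s ∈ A.succ q x) (w : ℕ → α) :
    w ∈ A.langFrom s ↔ (fun t => Nat.casesOn t x w : ℕ → α) ∈ A.langFrom q := by
  rw [hc.cons_mem_langFrom_iff (q := q) (w := fun t => Nat.casesOn t x w)]
  constructor
  · exact fun h => ⟨s, hs, h⟩
  · rintro ⟨s', hs', h⟩
    rw [hA.semantically_deterministic q x s hs s' hs']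
    exact h

/-- Two runs on the same word visit language equivalent states at every position. -/
theorem IsNice.langFrom_run_eq (hA : A.IsNice) (hc : A.IsCoBuchi) {q : Q} {w : ℕ → α}
    {π σ : ℕ → Q} (hπ : A.IsRunFrom q w π) (hσ : A.IsRunFrom q w σ) (i : ℕ) :
    A.langFrom (π i) = A.langFrom (σ i) := by
  induction i with
  | zero => rw [hπ.1, hσ.1]
  | succ i ih =>
    ext v
    rw [hA.mem_langFrom_succ_iff hc (hπ.2 i), hA.mem_langFrom_succ_iff hc (hσ.2 i), ih]

/-- A run of a canonical automaton that reaches a state from which the rest of the word can be read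
along accepting transitions takes accepting transitions only from there on. -/
theorem IsCanonicalGFGCoBuchi.accepting_of_mem_accLang (hA : A.IsCanonicalGFGCoBuchi) {q : Q}
    {w : ℕ → α} {π : ℕ → Q} (hπ : A.IsRunFrom q w π) {i : ℕ}
    (h : (fun t => w (i + t)) ∈ A.accLang (π i)) (t : ℕ) :
    A.trans (π (i + t)) (w (i + t)) (π (i + t + 1)) 2 := by
  obtain ⟨σ, h0, hσ⟩ := h
  have step : ∀ t, π (i + t) = σ t → A.trans (π (i + t)) (w (i + t)) (π (i + t + 1)) 2 := by
    intro t ht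
    obtain ⟨c, hc⟩ := hπ.2 (i + t)
    rcases hA.coBuchi _ _ _ _ hc with rfl | rfl
    · exact absurd (ht ▸ hσ t) (hA.rejMaximal.homogeneous _ _ _ _ hc)
    · exact hc
  refine step t ?_
  induction t with
  | zero => exact h0.symm
  | succ t ih =>
    have h' := step t ih
    rw [ih] at h'
    exact hA.nice.safe_deterministic _ _ _ _ h' (hσ t)

/-- A run is accepting if all its rejecting transitions from some point on lead to states from which
the rest of the word can be read along accepting transitions. -/
theorem IsCanonicalGFGCoBuchi.isAcceptingRunFrom (hA : A.IsCanonicalGFGCoBuchi) {q : Q}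
    {w : ℕ → α} {π : ℕ → Q} (hπ : A.IsRunFrom q w π)
    (h : ∀ᶠ i in Filter.atTop, A.trans (π i) (w i) (π (i + 1)) 1 →
      (fun t => w (i + 1 + t)) ∈ A.accLang (π (i + 1))) :
    A.IsAcceptingRunFrom q w π := by
  refine hA.coBuchi.isAcceptingRunFrom_iff.2 ⟨hπ, ?_⟩
  by_cases hr : ∃ᶠ i in Filter.atTop, A.trans (π i) (w i) (π (i + 1)) 1
  -- A single late rejecting transition suffices: everything after it is accepting.
  · obtain ⟨i, hi, hi'⟩ := (hr.and_eventually h).exists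
    filter_upwards [Filter.eventually_ge_atTop (i + 1)] with m hm
    obtain ⟨t, rfl⟩ := Nat.exists_eq_add_of_le hm
    exact hA.accepting_of_mem_accLang hπ (hi' hi) t
  · filter_upwards [Filter.not_frequently.1 hr] with i hi
    obtain ⟨c, hc⟩ := hπ.2 i
    rcases hA.coBuchi _ _ _ _ hc with rfl | rfl
    · exact absurd hc hi
    · exact hc

theorem IsCoBuchi.eventually_tail_mem_accLang (hA : A.IsCoBuchi) {q : Q} {w : ℕ → α}
    {π : ℕ → Q} (hπ : A.IsAcceptingRunFrom q w π) :
    ∀ᶠ i in Filter.atTop, (fun t => w (i + t)) ∈ A.accLang (π i) := by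
  obtain ⟨k, hk⟩ := Filter.eventually_atTop.1 (hA.isAcceptingRunFrom_iff.1 hπ).2
  filter_upwards [Filter.eventually_ge_atTop k] with i hi
  exact ⟨fun t => π (i + t), rfl, fun t => hk (i + t) (by omega)⟩

theorem succ_nonempty (q : Q) (x : α) : (A.succ q x).Nonempty := by
  obtain ⟨q', c, h⟩ := A.complete q x
  exact ⟨q', c, h⟩

end ParityAutomaton

/-! ### Simultaneous strategies for all levels -/

/-- A state of each level can be chosen subject to a satisfiable constraint that involves the states
chosen on the lower levels. -/
theorem exists_dependent_choice {n : ℕ} {Q : Fin n → Type*}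
    (P : (l : Fin n) → ((j : Fin n) → j < l → Q j) → Q l → Prop)
    (h : ∀ l r, ∃ s, P l r s) :
    ∃ t : (l : Fin n) → Q l, ∀ l, P l (fun j _ => t j) (t l) := by
  choose c hc using h
  let t : (l : Fin n) → Q l := (wellFounded_lt (α := Fin n)).fix c
  have ht : ∀ l, t l = c l (fun j _ => t j) := fun l => WellFounded.fix_eq _ _ _
  refine ⟨t, fun l => ?_⟩
  rw [ht l]
  exact hc _ _

/-- The iteration of a step function along a finite word that is given in reverse order. -/
def iterateStep {α S : Type*} (step : List α → S → α → S) (init : S) : List α → S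
  | [] => init
  | x :: u => step (x :: u).reverse (iterateStep step init u) x

section Chain

variable {α : Type*} {n : ℕ} {Q : Fin n → Type*} {A : (l : Fin n) → ParityAutomaton α (Q l)}

theorem IsCOCOA.mem_lang_of_le_naturalColor (hA : IsCOCOA A) {w : ℕ → α} {l : Fin n}
    (h : (l : ℕ) + 1 ≤ naturalColor A w) : w ∈ (A l).lang := by
  have hne : {k : ℕ | ∃ l : Fin n, k = (l : ℕ) + 1 ∧ w ∈ (A l).lang}.Nonempty := by
    rw [Set.nonempty_iff_ne_empty]
    intro he
    -- The default value 0 contradicts `h`, whose left side is positive.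
    rw [naturalColor, he, csSup_empty, bot_eq_zero] at h
    omega
  have hbdd : BddAbove {k : ℕ | ∃ l : Fin n, k = (l : ℕ) + 1 ∧ w ∈ (A l).lang} :=
    ⟨n, by rintro k ⟨l, rfl, -⟩; exact l.isLt⟩
  obtain ⟨m, hm, hw⟩ := Nat.sSup_mem hne hbdd
  rw [naturalColor, hm] at h
  exact hA.falling l m (Fin.le_def.2 (by omega)) hw

/-- The strategies follow the restrictions, and on each letter they select states that dominate a
successor of maximal age. -/
theorem exists_oldest_dominating_strategies
    {g : (l : Fin n) → Q l → α → ((j : Fin n) → j < l → Q j) → Set (Q l)}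
    (hg : IsRestriction A g) :
    ∃ f : (l : Fin n) → List α → Q l, SatisfyRestrictions A g f ∧
      ∀ (w : ℕ → α) (l : Fin n) (i : ℕ), ∃ s ∈ (A l).succ (strategyRun (f l) w i) (w i),
        (∀ s' ∈ (A l).succ (strategyRun (f l) w i) (w i), ∀ k,
          (A l).AcceptsSince k ((List.range (i + 1)).map w) s' →
          (A l).AcceptsSince k ((List.range (i + 1)).map w) s) ∧
        jointAccLang A l (fun j _ => strategyRun (f j) w (i + 1)) s ⊆
          jointAccLang A l (fun j _ => strategyRun (f j) w (i + 1))
            (strategyRun (f l) w (i + 1)) := by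
  have hstep : ∀ (v : List α) (q : (l : Fin n) → Q l) (x : α), ∃ t : (l : Fin n) → Q l, ∀ l,
      t l ∈ g l (q l) x (fun j _ => t j) ∧
      ∃ s ∈ (A l).succ (q l) x,
        (∀ s' ∈ (A l).succ (q l) x, ∀ k,
          (A l).AcceptsSince k v s' → (A l).AcceptsSince k v s) ∧
        jointAccLang A l (fun j _ => t j) s ⊆ jointAccLang A l (fun j _ => t j) (t l) := by
    intro v q x
    refine exists_dependent_choice (fun l r t => t ∈ g l (q l) x r ∧
      ∃ s ∈ (A l).succ (q l) x,
        (∀ s' ∈ (A l).succ (q l) x, ∀ k,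
          (A l).AcceptsSince k v s' → (A l).AcceptsSince k v s) ∧
        jointAccLang A l r s ⊆ jointAccLang A l r t) fun l r => ?_
    -- The oldest successor `s` is chosen without regard to the lower levels; only its dominating
    -- representative `t` depends on `r`.
    obtain ⟨s, hs, hold⟩ :=
      ParityAutomaton.exists_oldest (A := A l) v (ParityAutomaton.succ_nonempty (q l) x)
    obtain ⟨t, ht, hdom⟩ := (hg l (q l) x r).dominating s hs
    exact ⟨t, ht, s, hs, hold, hdom⟩
  choose step hstep using hstep
  -- Reversal puts the last letter first, where the recursion consumes it.
  let f : (l : Fin n) → List α → Q l :=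
    fun l v => iterateStep step (fun l => (A l).init) v.reverse l
  have hf : ∀ (w : ℕ → α) (i : ℕ) (l : Fin n), strategyRun (f l) w (i + 1) =
      step ((List.range (i + 1)).map w) (fun l => strategyRun (f l) w i) (w i) l := by
    intro w i l
    simp [strategyRun, f, List.range_succ, iterateStep]
  have hmem : ∀ (w : ℕ → α) (l : Fin n) (i : ℕ), strategyRun (f l) w (i + 1) ∈
      g l (strategyRun (f l) w i) (w i) (fun j _ => strategyRun (f j) w (i + 1)) := by
    intro w l i
    simp only [hf w i]
    exact (hstep _ _ _ l).1
  refine ⟨f, fun w l => ⟨⟨rfl, fun i => (hg _ _ _ _).subset_succ (hmem w l i)⟩, hmem w l⟩,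
    fun w l i => ?_⟩
  simp only [hf w i]
  exact (hstep _ (fun l => strategyRun (f l) w i) _ l).2

end Chain

theorem mainTheorem3 {α : Type*} [Finite α] {n : ℕ} {Q : Fin n → Type*} [∀ l, Finite (Q l)]
    (A : (l : Fin n) → ParityAutomaton α (Q l)) (hA : IsCOCOA A)
    (g : (l : Fin n) → Q l → α → ((j : Fin n) → j < l → Q j) → Set (Q l))
    (hg : IsRestriction A g) :
    ∃ f : (l : Fin n) → List α → Q l,
      SatisfyRestrictions A g f ∧
      ∀ (w : ℕ → α) (l : Fin n), (l : ℕ) + 1 ≤ naturalColor A w →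
        (A l).IsAcceptingRunFrom (A l).init w (strategyRun (f l) w) := by
  obtain ⟨f, hsat, hdom⟩ := exists_oldest_dominating_strategies hg
  refine ⟨f, hsat, fun w l => ?_⟩
  induction l using WellFoundedLT.induction with
  | ind l ih =>
  intro hl
  have hcan := hA.canonical l
  have hrun := (hsat w l).1
  have hlower : ∀ᶠ i in Filter.atTop, ∀ j, ∀ _ : j < l,
      (fun t => w (i + t)) ∈ (A j).accLang (strategyRun (f j) w i) := by
    refine Filter.eventually_all.2 fun j => Filter.eventually_all.2 fun hj => ?_
    refine (hA.canonical j).coBuchi.eventually_tail_mem_accLang (ih j hj ?_)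
    have := Fin.lt_def.1 hj
    omega
  obtain ⟨σ, hσ⟩ := hA.mem_lang_of_le_naturalColor hl
  obtain ⟨hσrun, hev⟩ := hcan.coBuchi.isAcceptingRunFrom_iff.1 hσ
  obtain ⟨k, hk⟩ := Filter.eventually_atTop.1 hev
  refine hcan.isAcceptingRunFrom hrun ?_
  -- The shift by one is needed because states are compared after reading letter `i`.
  filter_upwards [(Filter.tendsto_add_atTop_nat 1).eventually hlower,
    (Filter.tendsto_add_atTop_nat 1).eventually (hcan.nice.eventually_mem_accLang w k)]
    with i hlow hlive hrej
  obtain ⟨s, -, hold, hsub⟩ := hdom w l i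
  -- By homogeneity a rejecting transition excludes accepting ones on that letter, so maximality
  -- allows a move to any language equivalent state, even though `σ` may have visited other states
  -- before.
  have hσsucc : σ (i + 1) ∈ (A l).succ (strategyRun (f l) w i) (w i) :=
    hcan.rejMaximal.maximal _ _ (fun s' => hcan.rejMaximal.homogeneous _ _ _ s' hrej)
      _ (hrun.2 i) _ (hcan.nice.langFrom_run_eq hcan.coBuchi hσrun hrun (i + 1))
  have hs := hlive s (hold _ hσsucc k (ParityAutomaton.acceptsSince_prefix.2
    ⟨σ, rfl, fun t _ ht => hk t ht⟩))
  exact (hsub ⟨hlow, hs⟩).2
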